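/- Let $k$ be an algebraically closed field of characteristic zero and $R=k((X))[Y]$; subscripts $X,Y$ denote partial derivatives. Definitions. A nonzero $F\in R$ of $Y$-degree $N$ with leading coefficient $F_0\in k((X))$ is factored as $F=F_0\prod_{1\le j\le\chi(F)}F_j$ with $F_j\in R$ monic irreducible in $Y$; for $F=0$ put $\chi(F)=0$. $F$ is $k$-monic if $0\neq F_0\in k$. For an integer $\nu>0$ divisible by all the $\deg_Y F_j$, Newton's theorem gives $F(X^\nu,Y)=F_0(X^\nu)\prod_{1\le i\le N}(Y-z_i(X))$ with $z_i\in k((X))$. For $F\ne0\ne G$ and $M=\deg_Y G$, put $$\mathrm{int}(F,G)=\frac{M}{\nu}\,\mathrm{ord}_X F_0(X^\nu)+\frac1\nu\sum_{i=1}^N\mathrm{ord}_X\,G(X^\nu,z_i(X))\in\mathbb Q\cup\{\infty\},$$ which does not depend on the choice of $\nu$; if $F=0$ or $G=0$, put $\mathrm{int}(F,G)=0$ when the other one is a nonzero element of $k((X))$, and $\mathrm{int}(F,G)=\infty$ otherwise. $\mathrm{GCD}(F,G)=1$ means $\mathrm{int}(F,G)\neq\infty$. For a monic irreducible $P\in R$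 of positive $Y$-degree, $\mathrm{res}(P,G)$ is the unique $\lambda\in k$ such that $\mathrm{ord}_X(G(X^\nu,z_i(X))-\lambda)>0$ for the roots $z_i$ of $P(X^\nu,Y)$ if such a $\lambda$ exists, and $\infty$ otherwise. For $\lambda\in k$ let $\alpha_\lambda(F,G)=\{j:\mathrm{res}(F_j,G)=\lambda\}$ and $\beta_\lambda(F,G)=\sum_{j\in\alpha_\lambda(F,G)}\mathrm{int}(F_j,G-\lambda)$; let $\alpha(F,G)=\{\lambda\in k:\alpha_\lambda(F,G)\ne\emptyset\}$ (a finite set), $\beta(F,G)=\sum_{0\ne\lambda\in\alpha(F,G)}\beta_\lambda(F,G)$ and $\overline\beta(F)=\beta(F_Y,F)$. Theorem. (1) (Beta-derivative identity.) Let $F\in R$ be $k$-monic of $Y$-degree $N$, and let $G\in R$ be such that $\mathrm{GCD}(F,G-c)=1$ for all $c\in k$ and $G_Y\in F_jR$ for $1\le j\le\chi(F)$. Then $$\mathrm{int}(F,G_X)=\mathrm{int}(F,G)-N+\beta(F,G),$$ where each term is an integer. (2) (Betabar-derivative identity.) Let $F\in R$ be $k$-monic of $Y$-degree $N>0$ with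 $\mathrm{GCD}(F_Y,F-c)=1$ for all $c\in k$. Then $$\mathrm{int}(F_X,F_Y)=\mathrm{int}(F,F_Y)-N+1+\overline\beta(F),$$ where each term is an integer. -/

import Mathlib

open Polynomial
open scoped LaurentSeries

namespace MeromorphicCurve

noncomputable section

/-- The substitution `X ↦ X ^ ν` on `k((X))`, for a positive integer `ν`. -/
def ramify {k : Type*} [Field k] (ν : ℕ+) : k⸨X⸩ →+* k⸨X⸩ :=
  HahnSeries.embDomainRingHom (AddMonoidHom.mulLeft ((ν : ℕ) : ℤ))
    (fun a b h => by
      have hν : ((ν : ℕ) : ℤ) ≠ 0 := by exact_mod_cast ν.ne_zero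
      exact mul_left_cancel₀ hν h)
    (fun a b => by
      have hν : (0 : ℤ) < ((ν : ℕ) : ℤ) := by exact_mod_cast ν.pos
      exact mul_le_mul_iff_right₀ hν)

/-- A constant `c ∈ k`, viewed as an element of `R = k((X))[Y]`. -/
def const {k : Type*} [Field k] (c : k) : k⸨X⸩[X] :=
  Polynomial.C (HahnSeries.C c)

/-- The partial derivative `F_X` of `F ∈ k((X))[Y]`: every coefficient is differentiated with
respect to `X`. (The partial derivative `F_Y` is `Polynomial.derivative F`.) -/
def derivX {k : Type*} [Field k] (F : k⸨X⸩[X]) : k⸨X⸩[X] :=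
  F.sum fun n a => Polynomial.monomial n (LaurentSeries.hasseDeriv k 1 a)

/-- The ramification index `ν = N!`, where `N = deg_Y F`; it is divisible by the degrees of all
irreducible factors of `F`. -/
def ramIndex {k : Type*} [Field k] (F : k⸨X⸩[X]) : ℕ+ :=
  ⟨F.natDegree.factorial, F.natDegree.factorial_pos⟩

/-- The multiset `z₁(X), …, z_N(X)` of roots in `k((X))` of `F(X^ν, Y)`. When `k` is algebraically
closed of characteristic zero and `F ≠ 0`, Newton's theorem says that
`F(X^ν, Y) = F₀(X^ν) ∏ (Y - zᵢ(X))`. -/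
def newtonRoots {k : Type*} [Field k] (F : k⸨X⸩[X]) : Multiset k⸨X⸩ :=
  (F.map (ramify (ramIndex F))).roots

/-- `G(X^ν, z(X))`. -/
def substAt {k : Type*} [Field k] (ν : ℕ+) (G : k⸨X⸩[X]) (z : k⸨X⸩) : k⸨X⸩ :=
  (G.map (ramify ν)).eval z

open Classical in
/-- The intersection multiplicity `int(F, G)`, which is
`(M / ν) ord F₀(X^ν) + (1 / ν) ∑ᵢ ord G(X^ν, zᵢ(X))`, with `M = deg_Y G`, when `F ≠ 0 ≠ G`.
If one of `F`, `G` is zero it is `0` or `∞`, and it is `0` exactly when the other one is a nonzero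
element of `k((X))`. -/
def intMult {k : Type*} [Field k] (F G : k⸨X⸩[X]) : WithTop ℚ :=
  if F ≠ 0 ∧ G ≠ 0 then
    WithTop.map (fun m : ℤ => (m : ℚ) / ((ramIndex F : ℕ) : ℚ))
      (G.natDegree • (ramify (ramIndex F) F.leadingCoeff).orderTop +
        ((newtonRoots F).map fun z => (substAt (ramIndex F) G z).orderTop).sum)
  else if (F = 0 ∧ G ≠ 0 ∧ G.natDegree = 0) ∨ (G = 0 ∧ F ≠ 0 ∧ F.natDegree = 0) then 0
  else ⊤

/-- `GCD(F, G) = 1`, which means `int(F, G) ≠ ∞`. -/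
def GCDOne {k : Type*} [Field k] (F G : k⸨X⸩[X]) : Prop :=
  intMult F G ≠ ⊤

/-- `F` is `k`-monic: its leading coefficient in `Y` is a nonzero element of `k`. -/
def IsKMonic {k : Type*} [Field k] (F : k⸨X⸩[X]) : Prop :=
  ∃ a : k, a ≠ 0 ∧ F.leadingCoeff = HahnSeries.C a

open Classical in
/-- The multiset `F₁, …, F_χ` of monic irreducible factors of `F` in `k((X))[Y]`, counted with
multiplicity (empty for `F = 0`). -/
def branches {k : Type*} [Field k] (F : k⸨X⸩[X]) : Multiset k⸨X⸩[X] :=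
  UniqueFactorizationMonoid.normalizedFactors F

/-- `ord_X (G(X^ν, zᵢ(X)) - c) > 0` for all `i`, where the `zᵢ` are the roots of `P(X^ν, Y)`. -/
def HasResidue {k : Type*} [Field k] (P G : k⸨X⸩[X]) (c : k) : Prop :=
  ∀ z ∈ newtonRoots P, 0 < (substAt (ramIndex P) G z - HahnSeries.C c).orderTop

open Classical in
/-- The residue `res(P, G) ∈ k ∪ {∞}` of `G` at a monic irreducible `P`. -/
def res {k : Type*} [Field k] (P G : k⸨X⸩[X]) : OnePoint k :=
  if h : ∃ c : k, HasResidue P G c then ((h.choose : k) : OnePoint k) else OnePoint.infty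

open Classical in
/-- The invariant `α_c(F, G)`: the branches `F_j` of `F` with `res(F_j, G) = c`, as a multiset. -/
def alphaAt {k : Type*} [Field k] (c : k) (F G : k⸨X⸩[X]) : Multiset k⸨X⸩[X] :=
  (branches F).filter fun P => res P G = (c : OnePoint k)

/-- The invariant `β_c(F, G)`, the sum of `int(F_j, G - c)` over the branches in `α_c(F, G)`. -/
def betaAt {k : Type*} [Field k] (c : k) (F G : k⸨X⸩[X]) : WithTop ℚ :=
  ((alphaAt c F G).map fun P => intMult P (G - const c)).sum

/-- The alpha invariant `α(F, G)`. -/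
def alpha {k : Type*} [Field k] (F G : k⸨X⸩[X]) : Set k :=
  {c | alphaAt c F G ≠ 0}

theorem alpha_finite {k : Type*} [Field k] (F G : k⸨X⸩[X]) : (alpha F G).Finite := by
  classical
  have h : (((↑) : k → OnePoint k) '' alpha F G).Finite := by
    refine ((branches F).map fun P => res P G).toFinset.finite_toSet.subset ?_
    rintro _ ⟨c, hc, rfl⟩
    obtain ⟨P, hP⟩ := Multiset.exists_mem_of_ne_zero hc
    have hP' := Multiset.mem_filter.1 hP
    simp only [Finset.mem_coe, Multiset.mem_toFinset, Multiset.mem_map]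
    exact ⟨P, hP'.1, hP'.2⟩
  exact h.of_finite_image (OnePoint.coe_injective.injOn)

/-- The beta invariant `β(F, G)`, the sum of `β_c(F, G)` over the nonzero `c` in the finite set
`α(F, G)`. -/
def beta {k : Type*} [Field k] (F G : k⸨X⸩[X]) : WithTop ℚ :=
  ∑ c ∈ ((alpha_finite F G).subset (Set.sdiff_subset (t := {0}))).toFinset, betaAt c F G

/-- The betabar invariant of `F`. -/
def betaBar {k : Type*} [Field k] (F : k⸨X⸩[X]) : WithTop ℚ :=
  beta (derivative F) F

end

end MeromorphicCurve

open MeromorphicCurve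

/-!
Everything rests on reading `int(F, G)` as the order in `X` of the resultant of `F` and `G` with
respect to `Y` (`intMult_eq_orderTop_resultant`). Integrality, symmetry and additivity over the
branches of `F` follow, and the second identity becomes the first one applied to the pair
`(F_Y, F)`. The resultant is the product of the values of `G` at the roots of `F(X ^ ν, Y)` as soon
as that polynomial splits over `k((X))`, which is Newton's theorem.

*Newton's theorem.* A root in some `k((X ^ (1 / m)))` is found by induction on the degree
(`exists_ramify_root`): a Tschirnhaus transformation followed by a rescaling along the steepest
side of the Newton polygon gives a polynomial over `k[[X]]` whose reduction modulo `X` has a root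
without being a power of a linear polynomial, and the Weierstrass preparation theorem at that root
gives a proper factor. The substitutions `X ↦ u X`, with `u` an `m`-th root of unity, then act
transitively on the roots of an irreducible `P`, because the product of `Y - z'` over an orbit has
coefficients in `k((X ^ m))`. Counting the orbit shows that `P` of degree `n` already splits after
`X ↦ X ^ n` (`splits_map_ramify_natDegree`), so `F` splits after `X ↦ X ^ N!`.

*The identity on a branch* (`branch_identity`). Let `P` be irreducible with `P ∣ G_Y`, let `z` be a
root of `P(X ^ ν, Y)`, and put `g = G(X ^ ν, z)`. The term with `G_Y` drops out of the chain rule,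
so `X dg/dX = ν X ^ ν G_X(X ^ ν, z)`. The Euler operator `X d/dX` kills the constant term `g₀` of
`g` and preserves all other exponents of the support, hence
`ord G_X(X ^ ν, z) = ord (g - g₀) - ν`. Here `ord (g - g₀) = ord g` unless `ord g = 0`, in which
case `g₀` is the residue of `G` at `P` and `ord (g - g₀)` is what the beta invariant records.
Conjugacy of the roots makes `ord g` and `g₀` independent of `z`, so these contributions add up to
the identity for `P`, and summation over the branches proves the theorem.
-/

namespace MeromorphicCurve

/-! ### Coefficientwise operations on Laurent series -/

section Ramify

variable {k : Type*} [Field k]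

theorem ramify_coeff_mul (ν : ℕ+) (x : k⸨X⸩) (n : ℤ) :
    (ramify ν x).coeff (((ν : ℕ) : ℤ) * n) = x.coeff n :=
  HahnSeries.embDomain_mk_coeff (f := fun n : ℤ => ((ν : ℕ) : ℤ) * n) _ _

theorem ramify_coeff_of_not_dvd (ν : ℕ+) (x : k⸨X⸩) {n : ℤ} (h : ¬ ((ν : ℕ) : ℤ) ∣ n) :
    (ramify ν x).coeff n = 0 := by
  refine HahnSeries.embDomain_of_notMem_range ?_
  rintro ⟨m, rfl⟩
  exact h ⟨m, rfl⟩

theorem ramify_C (ν : ℕ+) (c : k) : ramify ν (HahnSeries.C c : k⸨X⸩) = HahnSeries.C c :=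
  HahnSeries.embDomainRingHom_C

theorem ramify_single (ν : ℕ+) (n : ℤ) (c : k) :
    ramify ν (HahnSeries.single n c : k⸨X⸩) = HahnSeries.single (((ν : ℕ) : ℤ) * n) c :=
  HahnSeries.embDomain_single

theorem ramify_injective (ν : ℕ+) : Function.Injective (ramify (k := k) ν) :=
  HahnSeries.embDomain_injective

theorem orderTop_ramify (ν : ℕ+) (x : k⸨X⸩) :
    (ramify ν x).orderTop = WithTop.map (fun n : ℤ => ((ν : ℕ) : ℤ) * n) x.orderTop :=
  HahnSeries.orderTop_embDomain

theorem ramify_ramify (μ ν : ℕ+) (x : k⸨X⸩) : ramify μ (ramify ν x) = ramify (μ * ν) x := by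
  ext n
  by_cases h : ((μ : ℕ) : ℤ) ∣ n
  · obtain ⟨n, rfl⟩ := h
    rw [ramify_coeff_mul]
    by_cases h : ((ν : ℕ) : ℤ) ∣ n
    · obtain ⟨n, rfl⟩ := h
      rw [ramify_coeff_mul, ← mul_assoc, ← Nat.cast_mul, ← PNat.mul_coe, ramify_coeff_mul]
    · rw [ramify_coeff_of_not_dvd _ _ h, ramify_coeff_of_not_dvd]
      rw [PNat.mul_coe, Nat.cast_mul]
      exact fun h' => h (Int.dvd_of_mul_dvd_mul_left (by exact_mod_cast μ.ne_zero) h')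
  · rw [ramify_coeff_of_not_dvd _ _ h, ramify_coeff_of_not_dvd]
    rw [PNat.mul_coe, Nat.cast_mul]
    exact fun h' => h (dvd_of_mul_right_dvd h')

theorem ramify_comp (μ ν : ℕ+) :
    (ramify (k := k) μ).comp (ramify ν) = ramify (μ * ν) :=
  RingHom.ext (ramify_ramify μ ν)

/-- A Laurent series lies in the image of `X ↦ X ^ ν` as soon as its exponents are divisible
by `ν`. -/
theorem exists_ramify_eq (ν : ℕ+) (x : k⸨X⸩)
    (h : ∀ n : ℤ, ¬ ((ν : ℕ) : ℤ) ∣ n → x.coeff n = 0) : ∃ y, ramify ν y = x := by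
  have hν : (0 : ℤ) < ((ν : ℕ) : ℤ) := by exact_mod_cast ν.pos
  have hb : BddBelow (Function.support fun n : ℤ => x.coeff (((ν : ℕ) : ℤ) * n)) := by
    refine ⟨-|x.order|, fun n hn => ?_⟩
    have h1 : x.order ≤ ((ν : ℕ) : ℤ) * n := HahnSeries.order_le_of_coeff_ne_zero hn
    rcases le_or_gt 0 n with h0 | h0
    · exact (neg_nonpos.2 (abs_nonneg _)).trans h0
    · have := neg_abs_le x.order
      nlinarith
  refine ⟨HahnSeries.ofSuppBddBelow _ hb, ?_⟩
  ext n
  by_cases hn : ((ν : ℕ) : ℤ) ∣ n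
  · obtain ⟨n, rfl⟩ := hn
    rw [ramify_coeff_mul]
    rfl
  · rw [ramify_coeff_of_not_dvd _ _ hn, h n hn]

/-- The Laurent series `∑ cₙ xₙ Xⁿ`, for `x = ∑ xₙ Xⁿ` and a family `c` of scalars. -/
noncomputable def coeffScale (c : ℤ → k) (x : k⸨X⸩) : k⸨X⸩ where
  coeff n := c n * x.coeff n
  isPWO_support' := x.isPWO_support.mono fun _ hn => right_ne_zero_of_mul hn

@[simp]
theorem coeffScale_coeff (c : ℤ → k) (x : k⸨X⸩) (n : ℤ) :
    (coeffScale c x).coeff n = c n * x.coeff n := rfl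

theorem support_coeffScale_subset (c : ℤ → k) (x : k⸨X⸩) :
    (coeffScale c x).support ⊆ x.support := fun _ hn => right_ne_zero_of_mul hn

/-- The coefficients of a product of rescaled series, as sums over the index set that computes the
coefficients of the product of the original ones. -/
theorem coeffScale_mul_coeff (c d : ℤ → k) (x y : k⸨X⸩) (n : ℤ) :
    (coeffScale c x * coeffScale d y).coeff n =
      ∑ ij ∈ Finset.antidiagonal x.isPWO_support y.isPWO_support n,
        c ij.1 * x.coeff ij.1 * (d ij.2 * y.coeff ij.2) := by
  rw [HahnSeries.coeff_mul]
  refine Finset.sum_subset ?_ ?_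
  · intro ij hij
    rw [Finset.mem_antidiagonal] at hij ⊢
    exact ⟨support_coeffScale_subset _ _ hij.1, support_coeffScale_subset _ _ hij.2.1, hij.2.2⟩
  · intro ij hij hij'
    rw [Finset.mem_antidiagonal] at hij hij'
    change (coeffScale c x).coeff ij.1 * (coeffScale d y).coeff ij.2 = 0
    by_contra h
    exact hij' ⟨left_ne_zero_of_mul h, right_ne_zero_of_mul h, hij.2.2⟩

theorem orderTop_coeffScale (c : ℤ → k) (x : k⸨X⸩) (h : ∀ n, x.coeff n ≠ 0 → c n ≠ 0) :
    (coeffScale c x).orderTop = x.orderTop := by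
  rcases eq_or_ne x 0 with rfl | hx
  · congr 1
    ext n
    simp
  · have h0 : x.coeff x.order ≠ 0 := by simpa using hx
    rw [← HahnSeries.order_eq_orderTop_of_ne_zero hx]
    refine HahnSeries.orderTop_eq_of_le ?_ ?_
    · exact mul_ne_zero (h _ h0) h0
    · intro n hn
      exact HahnSeries.order_le_of_coeff_ne_zero (support_coeffScale_subset c x hn)

/-- The automorphism `X ↦ u X` of `k((X))`, for a unit `u` of `k`. -/
noncomputable def twist (u : kˣ) : k⸨X⸩ →+* k⸨X⸩ where
  toFun := coeffScale fun n => ((u ^ n : kˣ) : k)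
  map_one' := by
    ext n
    by_cases hn : n = 0 <;> simp [HahnSeries.coeff_one, hn]
  map_zero' := by
    ext n
    simp
  map_add' x y := by
    ext n
    simp [mul_add]
  map_mul' x y := by
    ext n
    rw [coeffScale_mul_coeff, coeffScale_coeff, HahnSeries.coeff_mul, Finset.mul_sum]
    refine Finset.sum_congr rfl fun ij hij => ?_
    rw [← (Finset.mem_antidiagonal.1 hij).2.2, zpow_add, Units.val_mul]
    ring

theorem twist_coeff (u : kˣ) (x : k⸨X⸩) (n : ℤ) :
    (twist u x).coeff n = ((u ^ n : kˣ) : k) * x.coeff n := rfl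

theorem orderTop_twist (u : kˣ) (x : k⸨X⸩) : (twist u x).orderTop = x.orderTop :=
  orderTop_coeffScale _ _ fun _ _ => Units.ne_zero _

theorem twist_ramify (u : kˣ) (ν : ℕ+) (hu : u ^ (ν : ℕ) = 1) (x : k⸨X⸩) :
    twist u (ramify ν x) = ramify ν x := by
  ext n
  rw [twist_coeff]
  by_cases h : ((ν : ℕ) : ℤ) ∣ n
  · obtain ⟨n, rfl⟩ := h
    rw [zpow_mul, zpow_natCast, hu, one_zpow, Units.val_one, one_mul]
  · rw [ramify_coeff_of_not_dvd _ _ h, mul_zero]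

theorem twist_comp_ramify (u : kˣ) (ν : ℕ+) (hu : u ^ (ν : ℕ) = 1) :
    (twist u).comp (ramify ν) = ramify ν :=
  RingHom.ext (twist_ramify u ν hu)

theorem twist_twist (u v : kˣ) (x : k⸨X⸩) : twist u (twist v x) = twist (u * v) x := by
  ext n
  rw [twist_coeff, twist_coeff, twist_coeff, mul_zpow, Units.val_mul, mul_assoc]

theorem twist_one (x : k⸨X⸩) : twist (1 : kˣ) x = x := by
  ext n
  rw [twist_coeff, one_zpow, Units.val_one, one_mul]

/-- A Laurent series fixed by `X ↦ u X`, with `u` of order `ν`, is a series in `X ^ ν`. -/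
theorem exists_ramify_eq_of_twist_eq (u : kˣ) (ν : ℕ+) (hu : orderOf u = ν) (x : k⸨X⸩)
    (hx : twist u x = x) : ∃ y, ramify ν y = x := by
  refine exists_ramify_eq ν x fun n hn => ?_
  by_contra h
  have h1 : ((u ^ n : kˣ) : k) = 1 := by
    have := congrArg (fun y => HahnSeries.coeff y n) hx
    simp only [twist_coeff] at this
    exact mul_right_cancel₀ h (this.trans (one_mul _).symm)
  rw [← hu] at hn
  exact hn (orderOf_dvd_iff_zpow_eq_one.2 (Units.val_eq_one.1 h1))

end Ramify

section Euler

variable {k : Type*} [Field k]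

/-- The Euler operator `X d/dX` of `k((X))`. -/
noncomputable def euler : k⸨X⸩ →+ k⸨X⸩ where
  toFun := coeffScale fun n => (n : k)
  map_zero' := by ext n; simp
  map_add' x y := by ext n; simp [mul_add]

theorem euler_coeff (x : k⸨X⸩) (n : ℤ) : (euler x).coeff n = (n : k) * x.coeff n := rfl

theorem euler_mul (x y : k⸨X⸩) : euler (x * y) = x * euler y + euler x * y := by
  have h1 : coeffScale (fun _ => (1 : k)) x = x := by ext n; simp
  have h2 : coeffScale (fun _ => (1 : k)) y = y := by ext n; simp
  have h3 : x * euler y = coeffScale (fun _ => (1 : k)) x * coeffScale (fun n => (n : k)) y := by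
    rw [h1]; rfl
  have h4 : euler x * y = coeffScale (fun n => (n : k)) x * coeffScale (fun _ => (1 : k)) y := by
    rw [h2]; rfl
  ext n
  rw [HahnSeries.coeff_add, h3, h4, coeffScale_mul_coeff, coeffScale_mul_coeff, euler_coeff,
    HahnSeries.coeff_mul, Finset.mul_sum, ← Finset.sum_add_distrib]
  refine Finset.sum_congr rfl fun ij hij => ?_
  rw [← (Finset.mem_antidiagonal.1 hij).2.2, Int.cast_add]
  ring

theorem euler_pow (x : k⸨X⸩) (n : ℕ) : euler (x ^ n) = (n : k⸨X⸩) * x ^ (n - 1) * euler x := by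
  induction n with
  | zero =>
    ext m
    by_cases hm : m = 0 <;> simp [euler_coeff, HahnSeries.coeff_one, hm]
  | succ n ih =>
    rw [pow_succ, euler_mul, ih]
    rcases n with _ | n
    · simp
    · simp only [Nat.add_sub_cancel, pow_succ]
      push_cast
      ring

theorem euler_ramify (ν : ℕ+) (x : k⸨X⸩) :
    euler (ramify ν x) = ((ν : ℕ) : k⸨X⸩) * ramify ν (euler x) := by
  ext n
  rw [← nsmul_eq_mul, HahnSeries.coeff_nsmul, Pi.smul_apply, nsmul_eq_mul, euler_coeff]
  by_cases h : ((ν : ℕ) : ℤ) ∣ n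
  · obtain ⟨n, rfl⟩ := h
    rw [ramify_coeff_mul, ramify_coeff_mul, euler_coeff]
    push_cast
    ring
  · rw [ramify_coeff_of_not_dvd _ _ h, ramify_coeff_of_not_dvd _ _ h, mul_zero, mul_zero]

theorem euler_eq_single_mul (x : k⸨X⸩) :
    euler x = HahnSeries.single 1 1 * LaurentSeries.hasseDeriv k 1 x := by
  ext n
  obtain ⟨m, rfl⟩ : ∃ m, n = m + 1 := ⟨n - 1, by ring⟩
  rw [HahnSeries.coeff_single_mul_add, euler_coeff, LaurentSeries.hasseDeriv_coeff]
  simp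

/-- Differentiation kills exactly the constant term, so `X dg/dX` has the order of `g` stripped of
its constant term. -/
theorem orderTop_euler [CharZero k] (x : k⸨X⸩) :
    (euler x).orderTop = (x - HahnSeries.C (x.coeff 0)).orderTop := by
  have h : euler x = coeffScale (fun n => (n : k)) (x - HahnSeries.C (x.coeff 0)) := by
    ext n
    rcases eq_or_ne n 0 with rfl | hn
    · simp [euler_coeff]
    · simp [euler_coeff, HahnSeries.C_apply, HahnSeries.coeff_single_of_ne hn]
  rw [h]
  refine orderTop_coeffScale _ _ fun n hn h0 => hn ?_
  rw [Int.cast_eq_zero.1 h0]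
  simp [HahnSeries.C_apply]

theorem derivX_coeff (G : k⸨X⸩[X]) (n : ℕ) :
    (derivX G).coeff n = LaurentSeries.hasseDeriv k 1 (G.coeff n) := by
  rw [derivX, Polynomial.sum_def, Polynomial.finsetSum_coeff]
  simp only [Polynomial.coeff_monomial]
  rw [Finset.sum_ite_eq']
  split_ifs with h
  · rfl
  · rw [Polynomial.notMem_support_iff.1 h, map_zero]

/-- The chain rule for `X d/dX` applied to `G(X ^ ν, z(X))`. -/
theorem euler_substAt (ν : ℕ+) (G : k⸨X⸩[X]) (z : k⸨X⸩) :
    euler (substAt ν G z) =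
      ((ν : ℕ) : k⸨X⸩) * (HahnSeries.single ((ν : ℕ) : ℤ) 1 * substAt ν (derivX G) z) +
        substAt ν (derivative G) z * euler z := by
  simp only [substAt]
  rw [← Polynomial.derivative_map]
  induction G using Polynomial.induction_on' with
  | add p q hp hq =>
    have hd : derivX (p + q) = derivX p + derivX q := by
      ext1 n
      simp only [derivX_coeff, Polynomial.coeff_add, map_add]
    simp only [hd, Polynomial.map_add, Polynomial.eval_add, map_add, hp, hq]
    ring
  | monomial n a =>
    have hd : derivX (monomial n a) = monomial n (LaurentSeries.hasseDeriv k 1 a) := by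
      rw [derivX, Polynomial.sum_monomial_index _ _ (by simp)]
    have ha : euler (ramify ν a) = ((ν : ℕ) : k⸨X⸩) * (HahnSeries.single ((ν : ℕ) : ℤ) 1 *
        ramify ν (LaurentSeries.hasseDeriv k 1 a)) := by
      rw [euler_ramify, euler_eq_single_mul, map_mul, ramify_single, mul_one]
    simp only [hd, Polynomial.map_monomial, Polynomial.eval_monomial, euler_mul, euler_pow, ha,
      Polynomial.derivative_monomial]
    ring

end Euler

/-! ### Newton's theorem -/

section Hensel

/-- Weierstrass preparation as a factorization criterion: over a complete local ring, a polynomial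
whose reduction vanishes at `0` and has a nonzero coefficient in degree `i` has a monic factor of
positive degree at most `i`. For a monic polynomial, the factor is proper if `i` is less than the
degree. -/
theorem exists_monic_dvd_of_coeff_mem {A : Type*} [CommRing A] [IsLocalRing A]
    [IsAdicComplete (IsLocalRing.maximalIdeal A) A] (F : A[X])
    (h0 : F.coeff 0 ∈ IsLocalRing.maximalIdeal A)
    {i : ℕ} (hi : F.coeff i ∉ IsLocalRing.maximalIdeal A) :
    ∃ g : A[X], g.Monic ∧ g ∣ F ∧ 0 < g.natDegree ∧ g.natDegree ≤ i := by
  have hc : ∀ j, PowerSeries.coeff j ((F : PowerSeries A).map (IsLocalRing.residue A)) =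
      IsLocalRing.residue A (F.coeff j) := fun j => by
    rw [PowerSeries.coeff_map, Polynomial.coeff_coe]
  have hci : PowerSeries.coeff i ((F : PowerSeries A).map (IsLocalRing.residue A)) ≠ 0 := by
    rw [hc, Ne, IsLocalRing.residue_eq_zero_iff]
    exact hi
  have hne : (F : PowerSeries A).map (IsLocalRing.residue A) ≠ 0 := fun h => hci (by simp [h])
  obtain ⟨g, h, H⟩ := PowerSeries.exists_isWeierstrassFactorization hne
  have hdeg := H.natDegree_eq_toNat_order_map
  have hm := H.isDistinguishedAt.monic
  refine ⟨g, hm, ?_, ?_, ?_⟩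
  · -- Polynomial division of `F` by `g` is also the Weierstrass division, with remainder `0`.
    have hg : ((g : PowerSeries A).map (IsLocalRing.residue A)).order = (g.natDegree : ℕ∞) :=
      (H.isDistinguishedAt.coe_natDegree_eq_order_map g 1
        (by rw [map_one, ← Ideal.ne_top_iff_one]; exact Ideal.IsMaximal.ne_top inferInstance)
        (by simp)).symm
    have hg' : ((g : PowerSeries A).map (Ideal.Quotient.mk
        (IsLocalRing.maximalIdeal A))).order.toNat = g.natDegree := by
      rw [← ENat.toNat_natCast g.natDegree, ← hg]
      rfl
    refine (Polynomial.modByMonic_eq_zero_iff_dvd hm).1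
      (H.isDistinguishedAt.isWeierstrassDivisorAt'.eq_of_mul_add_eq_mul_add
        (q := ((F /ₘ g : A[X]) : PowerSeries A)) (q' := h) (r := F %ₘ g) (r' := 0) ?_ ?_ ?_).2
    · rw [hg', ← Polynomial.degree_eq_natDegree hm.ne_zero]
      exact Polynomial.degree_modByMonic_lt F hm
    · rw [hg', Polynomial.degree_zero]
      exact WithBot.bot_lt_coe _
    · rw [Polynomial.coe_zero, add_zero, ← H.eq_mul, ← Polynomial.coe_mul, ← Polynomial.coe_add,
        add_comm, Polynomial.modByMonic_add_div F g]
  · rw [pos_iff_ne_zero]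
    intro h
    have := PowerSeries.coeff_order hne
    rw [← hdeg, h, hc] at this
    exact this ((IsLocalRing.residue_eq_zero_iff _).2 h0)
  · rw [hdeg]
    exact ENat.toNat_le_of_le_natCast (PowerSeries.order_le i hci)

end Hensel

section Newton

variable {k : Type*} [Field k]

instance isAdicComplete_powerSeries :
    IsAdicComplete (IsLocalRing.maximalIdeal (PowerSeries k)) (PowerSeries k) := by
  rw [PowerSeries.maximalIdeal_eq_span_X]
  infer_instance

/-- A series of nonnegative order is a power series. -/
theorem exists_ofPowerSeries_eq (x : k⸨X⸩) (h : 0 ≤ x.orderTop) :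
    ∃ y : PowerSeries k, HahnSeries.ofPowerSeries ℤ k y = x := by
  refine ⟨PowerSeries.mk fun n => x.coeff n, ?_⟩
  ext n
  rw [PowerSeries.coeff_coe]
  split_ifs with hn
  · exact (HahnSeries.coeff_eq_zero_of_lt_orderTop
      (lt_of_lt_of_le (WithTop.coe_lt_coe.2 hn) h)).symm
  · rw [PowerSeries.coeff_mk, Int.natAbs_of_nonneg (not_lt.1 hn)]

/-- The coefficient of `Y ^ (n - 1)` in `F(Y + r)`, for `F` of degree `n`. -/
theorem coeff_taylor_natDegree_sub_one {R : Type*} [CommRing R] (F : R[X]) (r : R) {n : ℕ}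
    (hn : F.natDegree = n + 1) :
    (taylor r F).coeff n = F.coeff n + (n + 1) * F.leadingCoeff * r := by
  have hd : (hasseDeriv n F).natDegree < 2 := by
    have := natDegree_hasseDeriv_le F n
    omega
  rw [taylor_coeff, eval_eq_sum_range' hd, Finset.sum_range_succ, Finset.sum_range_one,
    hasseDeriv_coeff, hasseDeriv_coeff, leadingCoeff, hn, add_comm 1 n]
  simp

/-- The factorization step in Newton's algorithm: after the Tschirnhaus transformation and a
rescaling which makes the polynomial integral with a nontrivial reduction, it has a proper factor,
because its reduction has a root and is not the power of a linear polynomial. -/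
theorem exists_monic_dvd_of_reduction [IsAlgClosed k] [CharZero k] (F : (PowerSeries k)[X])
    (hF : F.Monic) {n : ℕ} (hn : F.natDegree = n + 1)
    (h1 : PowerSeries.constantCoeff (F.coeff n) = 0)
    {i : ℕ} (hi : i < n + 1) (hi' : PowerSeries.constantCoeff (F.coeff i) ≠ 0) :
    ∃ g : (PowerSeries k)[X], g.Monic ∧ g ∣ F ∧ 0 < g.natDegree ∧ g.natDegree < n + 1 := by
  have hmem : ∀ a : PowerSeries k, a ∈ IsLocalRing.maximalIdeal (PowerSeries k) ↔
      PowerSeries.constantCoeff a = 0 := fun a => by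
    rw [PowerSeries.maximalIdeal_eq_span_X, Ideal.mem_span_singleton, PowerSeries.X_dvd_iff]
  set f : k[X] := F.map PowerSeries.constantCoeff with hf
  have hfm : f.Monic := hF.map _
  have hfn : f.natDegree = n + 1 := (hF.natDegree_map _).trans hn
  obtain ⟨c, hc⟩ := IsAlgClosed.exists_root f (by
    rw [degree_eq_natDegree hfm.ne_zero, hfn]
    exact_mod_cast n.succ_ne_zero)
  have hT : (taylor (PowerSeries.C c) F).map PowerSeries.constantCoeff = taylor c f := by
    rw [map_taylor, PowerSeries.constantCoeff_C]
  have hTc : ∀ j, PowerSeries.constantCoeff ((taylor (PowerSeries.C c) F).coeff j) =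
      (taylor c f).coeff j := fun j => by rw [← hT, coeff_map]
  -- Otherwise `f = (Y - c) ^ (n + 1)`, so that `c = 0` by the vanishing of the next coefficient.
  obtain ⟨j, hj, hj'⟩ : ∃ j < n + 1, (taylor c f).coeff j ≠ 0 := by
    by_contra! hcon
    have h2 := coeff_taylor_natDegree_sub_one f c hfn
    rw [hcon n n.lt_succ_self, hf, coeff_map, h1, ← hf, hfm.leadingCoeff, zero_add, mul_one,
      zero_eq_mul] at h2
    have hc0 : c = 0 := h2.resolve_left (by exact_mod_cast n.succ_ne_zero)
    refine hi' ?_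
    have := hcon i hi
    rwa [hc0, taylor_zero, hf, coeff_map] at this
  obtain ⟨g, hg, hgF, hg0, hgj⟩ := exists_monic_dvd_of_coeff_mem (taylor (PowerSeries.C c) F)
    (i := j) (by
      rw [hmem, hTc, taylor_coeff_zero]
      exact hc) (by rwa [hmem, hTc])
  refine ⟨taylor (-PowerSeries.C c) g, ?_, ?_, ?_, ?_⟩
  · rw [Monic, leadingCoeff_taylor, hg]
  · obtain ⟨q, hq⟩ := hgF
    refine ⟨taylor (-PowerSeries.C c) q, ?_⟩
    rw [← taylor_mul, ← hq, taylor_taylor, neg_add_cancel, taylor_zero]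
  · rwa [natDegree_taylor]
  · rw [natDegree_taylor]
    omega

/-- The steepest side of the Newton polygon: after a substitution `X ↦ X ^ q` and a rescaling
`Y ↦ X ^ p Y`, a polynomial other than a power of `Y` becomes integral, and a coefficient besides
the leading one does not vanish at `X = 0`. -/
theorem exists_integral_scaleRoots (F : k⸨X⸩[X]) (hF : F.Monic) {n : ℕ}
    (hn : F.natDegree = n + 1) (hne : ∃ i < n + 1, F.coeff i ≠ 0) :
    ∃ (q : ℕ+) (s : k⸨X⸩) (F₁ : (PowerSeries k)[X]), s ≠ 0 ∧
      F₁.map (HahnSeries.ofPowerSeries ℤ k) = (F.map (ramify q)).scaleRoots s ∧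
      F₁.Monic ∧ F₁.natDegree = n + 1 ∧
      ∃ i < n + 1, PowerSeries.constantCoeff (F₁.coeff i) ≠ 0 := by
  classical
  -- `q` is divisible by all `n + 1 - i`, which makes all slopes integers.
  set q : ℕ+ := ⟨(n + 1).factorial, (n + 1).factorial_pos⟩ with hq
  have hdvd : ∀ i < n + 1, ((n + 1 - i : ℕ) : ℤ) ∣ ((q : ℕ) : ℤ) := fun i hi => by
    exact_mod_cast Nat.dvd_factorial (by omega) (by omega)
  set slope : ℕ → ℤ := fun i => ((q : ℕ) : ℤ) * (F.coeff i).order / ((n + 1 - i : ℕ) : ℤ)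
    with hslope
  have hslope' : ∀ i < n + 1,
      ((q : ℕ) : ℤ) * (F.coeff i).order = slope i * ((n + 1 - i : ℕ) : ℤ) := fun i hi =>
    (Int.ediv_mul_cancel ((hdvd i hi).mul_right _)).symm
  obtain ⟨i₀, hi₀, hmin⟩ := Finset.exists_min_image
    ((Finset.range (n + 1)).filter fun i => F.coeff i ≠ 0) slope (by
      obtain ⟨i, hi, hi'⟩ := hne
      exact ⟨i, Finset.mem_filter.2 ⟨Finset.mem_range.2 hi, hi'⟩⟩)
  rw [Finset.mem_filter, Finset.mem_range] at hi₀
  set p := slope i₀ with hp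
  set s : k⸨X⸩ := HahnSeries.single (-p) 1 with hs
  have hs0 : s ≠ 0 := by simp [hs]
  have hcoeff : ∀ i, ((F.map (ramify q)).scaleRoots s).coeff i =
      ramify q (F.coeff i) * HahnSeries.single (((n + 1 - i : ℕ) : ℤ) * -p) 1 := fun i => by
    rw [coeff_scaleRoots, coeff_map, hF.natDegree_map, hn, hs, HahnSeries.single_pow, one_pow,
      nsmul_eq_mul]
  have hord : ∀ i, F.coeff i ≠ 0 → (((F.map (ramify q)).scaleRoots s).coeff i).orderTop =
      ((((q : ℕ) : ℤ) * (F.coeff i).order + ((n + 1 - i : ℕ) : ℤ) * -p : ℤ) : WithTop ℤ) :=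
    fun i hi => by
      rw [hcoeff, HahnSeries.orderTop_mul, orderTop_ramify, HahnSeries.orderTop_single one_ne_zero,
        ← HahnSeries.order_eq_orderTop_of_ne_zero hi, WithTop.map_coe, WithTop.coe_add]
  have hmonic : ((F.map (ramify q)).scaleRoots s).Monic :=
    (monic_scaleRoots_iff s).2 (hF.map _)
  have hnat : ((F.map (ramify q)).scaleRoots s).natDegree = n + 1 := by
    rw [natDegree_scaleRoots, hF.natDegree_map, hn]
  have hlift : (F.map (ramify q)).scaleRoots s ∈ lifts (HahnSeries.ofPowerSeries ℤ k) := by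
    rw [lifts_iff_coeff_lifts]
    intro i
    rcases lt_trichotomy i (n + 1) with hi | hi | hi
    · refine exists_ofPowerSeries_eq _ ?_
      by_cases h0 : F.coeff i = 0
      · rw [hcoeff, h0, map_zero, zero_mul, HahnSeries.orderTop_zero]
        exact le_top
      · rw [hord i h0, hslope' i hi]
        have h1 := hmin i (Finset.mem_filter.2 ⟨Finset.mem_range.2 hi, h0⟩)
        have h2 : (0 : ℤ) ≤ ((n + 1 - i : ℕ) : ℤ) := Int.natCast_nonneg _
        have h3 : (0 : ℤ) ≤ slope i * ((n + 1 - i : ℕ) : ℤ) + ((n + 1 - i : ℕ) : ℤ) * -p := by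
          nlinarith
        exact_mod_cast h3
    · refine ⟨1, ?_⟩
      rw [map_one, hi, ← hnat]
      exact hmonic.symm
    · refine ⟨0, ?_⟩
      rw [map_zero, coeff_eq_zero_of_natDegree_lt (hnat.trans_lt hi)]
  obtain ⟨F₁, hF₁, hF₁n, hF₁m⟩ := lifts_and_natDegree_eq_and_monic hlift hmonic
  refine ⟨q, s, F₁, hs0, hF₁, hF₁m, hF₁n.trans hnat, i₀, hi₀.1, ?_⟩
  have h1 : (((F.map (ramify q)).scaleRoots s).coeff i₀).orderTop = ((0 : ℤ) : WithTop ℤ) := by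
    rw [hord i₀ hi₀.2, hslope' i₀ hi₀.1]
    congr 1
    ring
  have h2 := HahnSeries.coeff_orderTop_ne h1
  rw [← hF₁, coeff_map, PowerSeries.coeff_coe] at h2
  simpa using h2

/-- **Newton's theorem**, existence of a fractional power series root: a monic polynomial over
`k((X))` of positive degree has a root in `k((X ^ (1 / m)))` for some `m`. -/
theorem exists_ramify_root [IsAlgClosed k] [CharZero k] (F : k⸨X⸩[X]) (hF : F.Monic)
    (hpos : 0 < F.natDegree) : ∃ (m : ℕ+) (z : k⸨X⸩), (F.map (ramify m)).eval z = 0 := by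
  induction hN : F.natDegree using Nat.strong_induction_on generalizing F with
  | _ N ih =>
  obtain ⟨n, rfl⟩ : ∃ n, N = n + 1 := ⟨N - 1, by omega⟩
  -- The Tschirnhaus transformation removes the coefficient of `Y ^ (N - 1)`.
  set r : k⸨X⸩ := -F.coeff n / ((n : k⸨X⸩) + 1) with hr
  have hchar : ((n : k⸨X⸩) + 1) ≠ 0 := by
    have : CharZero k⸨X⸩ := charZero_of_injective_ringHom HahnSeries.C_injective
    exact_mod_cast n.succ_ne_zero
  set T := taylor r F with hT
  have hTm : T.Monic := by rw [Monic, hT, leadingCoeff_taylor, hF]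
  have hTn : T.natDegree = n + 1 := by rw [hT, natDegree_taylor, hN]
  have hT0 : T.coeff n = 0 := by
    rw [hT, coeff_taylor_natDegree_sub_one F r hN, hF.leadingCoeff, hr]
    field_simp
    ring
  suffices h : ∃ (m : ℕ+) (z : k⸨X⸩), (T.map (ramify m)).eval z = 0 by
    obtain ⟨m, z, h⟩ := h
    rw [hT, map_taylor, taylor_eval] at h
    exact ⟨m, _, h⟩
  by_cases hne : ∃ i < n + 1, T.coeff i ≠ 0
  swap
  · push Not at hne
    refine ⟨1, 0, ?_⟩
    rw [← coeff_zero_eq_eval_zero, coeff_map, hne 0 n.succ_pos, map_zero]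
  obtain ⟨q, s, T₁, hs, hT₁, hT₁m, hT₁n, i, hi, hi'⟩ := exists_integral_scaleRoots T hTm hTn hne
  have h1 : PowerSeries.constantCoeff (T₁.coeff n) = 0 := by
    have h2 : HahnSeries.ofPowerSeries ℤ k (T₁.coeff n) = 0 := by
      rw [← coeff_map, hT₁, coeff_scaleRoots, coeff_map, hT0, map_zero, zero_mul]
    rw [(map_eq_zero_iff _ HahnSeries.ofPowerSeries_injective).1 h2, map_zero]
  obtain ⟨g, hgm, ⟨t, ht⟩, hg0, hgn⟩ := exists_monic_dvd_of_reduction T₁ hT₁m hT₁n h1 hi hi'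
  obtain ⟨m, z, hz⟩ := ih g.natDegree hgn (g.map (HahnSeries.ofPowerSeries ℤ k)) (hgm.map _)
    (by rwa [hgm.natDegree_map]) (hgm.natDegree_map _)
  have hz' : ((T₁.map (HahnSeries.ofPowerSeries ℤ k)).map (ramify m)).eval z = 0 := by
    rw [ht, Polynomial.map_mul, Polynomial.map_mul, eval_mul, hz, zero_mul]
  have hms : ramify m s ≠ 0 := by
    rwa [Ne, map_eq_zero_iff _ (ramify_injective m)]
  refine ⟨m * q, (ramify m s)⁻¹ * z, ?_⟩
  rw [hT₁, map_scaleRoots _ _ _ (by simp [(hTm.map (ramify q)).leadingCoeff]), map_map,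
    ramify_comp] at hz'
  have h3 := scaleRoots_eval_mul (T.map (ramify (m * q))) ((ramify m s)⁻¹ * z) (ramify m s)
  rw [mul_inv_cancel_left₀ hms, hz', zero_eq_mul] at h3
  exact h3.resolve_left (pow_ne_zero _ hms)

end Newton

/-! ### Conjugate roots and splitting -/

section Orbit

variable {k : Type*} [Field k]

theorem twist_iterate (u : kˣ) (i : ℕ) (z : k⸨X⸩) : (twist u)^[i] z = twist (u ^ i) z := by
  induction i with
  | zero => rw [Function.iterate_zero_apply, pow_zero, twist_one]
  | succ i ih => rw [Function.iterate_succ_apply', ih, twist_twist, pow_succ']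

/-- The product of `Y - z'` over the conjugates `z'` of `z` under `X ↦ u X`, where `u` has order
`ν`, is the image of a polynomial under `X ↦ X ^ ν`. -/
theorem exists_map_ramify_eq_orbit_prod (u : kˣ) (ν : ℕ+) (hu : orderOf u = ν) (z : k⸨X⸩) {s : ℕ}
    (hz : (twist u)^[s] z = z) :
    ∃ Q : k⸨X⸩[X], Q.map (ramify ν) =
      ∏ i ∈ Finset.range s, (Polynomial.X - Polynomial.C ((twist u)^[i] z)) := by
  set O : k⸨X⸩[X] := ∏ i ∈ Finset.range s, (Polynomial.X - Polynomial.C ((twist u)^[i] z))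
    with hO
  have hfix : O.map (twist u) = O := by
    have h1 : O.map (twist u) =
        ∏ i ∈ Finset.range s, (Polynomial.X - Polynomial.C ((twist u)^[i + 1] z)) := by
      rw [hO, Polynomial.map_prod]
      refine Finset.prod_congr rfl fun i _ => ?_
      rw [Polynomial.map_sub, map_X, map_C, Function.iterate_succ_apply']
    have h2 := Finset.prod_range_succ
      (fun i => Polynomial.X - Polynomial.C ((twist u)^[i] z)) s
    rw [Finset.prod_range_succ', hz, Function.iterate_zero_apply] at h2
    rw [h1]
    exact mul_right_cancel₀ (X_sub_C_ne_zero z) h2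
  have hl : O ∈ lifts (ramify ν) := by
    rw [lifts_iff_coeff_lifts]
    intro i
    refine exists_ramify_eq_of_twist_eq u ν hu _ ?_
    rw [← coeff_map, hfix]
  exact hl

theorem twist_substAt (u : kˣ) (ν : ℕ+) (hu : u ^ (ν : ℕ) = 1) (G : k⸨X⸩[X]) (z : k⸨X⸩) :
    twist u (substAt ν G z) = substAt ν G (twist u z) := by
  rw [substAt, substAt, ← eval_map_apply, map_map, twist_comp_ramify u ν hu]

/-- The roots of `P(X ^ ν, Y)`, for `P` irreducible, are conjugate: they all occur in the orbit of
any one of them under `X ↦ u X`, for `u` of order `ν`. -/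
theorem map_ramify_dvd_orbit_prod {P : k⸨X⸩[X]} (hP : Irreducible P) (u : kˣ) (ν : ℕ+)
    (hu : orderOf u = ν) {z : k⸨X⸩} (hz : substAt ν P z = 0) {s : ℕ} (hs : 0 < s)
    (hper : (twist u)^[s] z = z) :
    P.map (ramify ν) ∣ ∏ i ∈ Finset.range s, (X - C ((twist u)^[i] z)) := by
  obtain ⟨Q, hQ⟩ := exists_map_ramify_eq_orbit_prod u ν hu z hper
  rw [← hQ]
  refine Polynomial.map_dvd _ ?_
  by_contra hPQ
  obtain ⟨a, b, hab⟩ := hP.coprime_iff_not_dvd.2 hPQ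
  have h1 := congrArg (fun f => eval z (f.map (ramify ν))) hab
  have hQz : eval z (Q.map (ramify ν)) = 0 := by
    rw [hQ, eval_prod]
    refine Finset.prod_eq_zero (Finset.mem_range.2 hs) ?_
    rw [Function.iterate_zero_apply, eval_sub, eval_X, eval_C, sub_self]
  have hPz : eval z (P.map (ramify ν)) = 0 := hz
  simp [hQz, hPz] at h1

theorem splits_map_ramify_of_root {P : k⸨X⸩[X]} (hP : Irreducible P) (u : kˣ) (ν : ℕ+)
    (hu : orderOf u = ν) {z : k⸨X⸩} (hz : substAt ν P z = 0) : (P.map (ramify ν)).Splits := by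
  refine Splits.of_dvd (Splits.prod fun i _ => Splits.X_sub_C _)
    (Finset.prod_ne_zero_iff.2 fun i _ => X_sub_C_ne_zero _)
    (map_ramify_dvd_orbit_prod hP u ν hu hz ν.pos ?_)
  rw [twist_iterate, ← hu, pow_orderOf_eq_one, twist_one]

theorem exists_twist_eq_of_roots {P : k⸨X⸩[X]} (hP : Irreducible P) (u : kˣ) (ν : ℕ+)
    (hu : orderOf u = ν) {z w : k⸨X⸩} (hz : substAt ν P z = 0) (hw : substAt ν P w = 0) :
    ∃ i : ℕ, twist (u ^ i) z = w := by
  have hdvd := map_ramify_dvd_orbit_prod hP u ν hu hz ν.pos (by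
    rw [twist_iterate, ← hu, pow_orderOf_eq_one, twist_one])
  have h0 := eval_eq_zero_of_dvd_of_eval_eq_zero hdvd hw
  rw [eval_prod, Finset.prod_eq_zero_iff] at h0
  obtain ⟨i, -, hi⟩ := h0
  rw [eval_sub, eval_X, eval_C, sub_eq_zero, twist_iterate] at hi
  exact ⟨i, hi.symm⟩

end Orbit

section Splitting

variable {k : Type*} [Field k] [IsAlgClosed k] [CharZero k]

variable (k) in
theorem exists_unit_orderOf_eq (ν : ℕ+) : ∃ u : kˣ, orderOf u = ν := by
  have : NeZero ((ν : ℕ) : k) := ⟨by exact_mod_cast ν.ne_zero⟩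
  obtain ⟨ζ, hζ⟩ := HasEnoughRootsOfUnity.exists_primitiveRoot k (ν : ℕ)
  refine ⟨(hζ.isUnit ν.ne_zero).unit, ?_⟩
  rw [← orderOf_units, IsUnit.unit_spec, ← hζ.eq_orderOf]

/-- **Newton's theorem** with control of the ramification: an irreducible polynomial of degree `n`
splits after `X ↦ X ^ n`. The degree is the size of the orbit of a root, and a root whose orbit
under the `m`-th roots of unity has size `n` is a series in `X ^ (m / n)`. -/
theorem splits_map_ramify_natDegree {P : k⸨X⸩[X]} (hP : Irreducible P) (n : ℕ+)
    (hn : P.natDegree = n) : (P.map (ramify n)).Splits := by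
  obtain ⟨m, z, hz'⟩ := exists_ramify_root (P * C P.leadingCoeff⁻¹)
    (monic_mul_leadingCoeff_inv hP.ne_zero) (by
      rw [natDegree_mul_leadingCoeff_inv P hP.ne_zero, hn]
      exact n.pos)
  have hz : substAt m P z = 0 := by
    have hlc : ramify m P.leadingCoeff⁻¹ ≠ 0 := by
      rw [Ne, map_eq_zero_iff _ (ramify_injective m), inv_eq_zero, leadingCoeff_eq_zero]
      exact hP.ne_zero
    rw [Polynomial.map_mul, map_C, eval_mul, eval_C] at hz'
    exact (mul_eq_zero.1 hz').resolve_right hlc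
  obtain ⟨u, hu⟩ := exists_unit_orderOf_eq k m
  have hum : u ^ (m : ℕ) = 1 := by rw [← hu, pow_orderOf_eq_one]
  have hper : Function.IsPeriodicPt (twist u) m z := by
    rw [Function.IsPeriodicPt, Function.IsFixedPt, twist_iterate, hum, twist_one]
  have hdvd : Function.minimalPeriod (twist u) z ∣ m := hper.minimalPeriod_dvd
  have hpos := hper.minimalPeriod_pos m.pos
  set s := Function.minimalPeriod (twist u) z with hs
  have h1 := map_ramify_dvd_orbit_prod hP u m hu hz hpos Function.iterate_minimalPeriod
  have h2 : ∏ i ∈ Finset.range s, (X - C ((twist u)^[i] z)) ∣ P.map (ramify m) := by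
    refine Finset.prod_dvd_of_coprime ?_ ?_
    · intro i hi j hj hij
      refine isCoprime_X_sub_C_of_isUnit_sub (isUnit_iff_ne_zero.2 (sub_ne_zero.2 fun h => hij ?_))
      exact Function.iterate_injOn_Iio_minimalPeriod
        (Set.mem_Iio.2 (Finset.mem_range.1 hi)) (Set.mem_Iio.2 (Finset.mem_range.1 hj)) h
    · intro i _
      rw [dvd_iff_isRoot, IsRoot, twist_iterate]
      change substAt m P _ = 0
      rw [← twist_substAt _ _ (by rw [← pow_mul, mul_comm, pow_mul, hum, one_pow]), hz, map_zero]
  have hP0 : P.map (ramify m) ≠ 0 :=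
    (Polynomial.map_ne_zero_iff (ramify_injective m)).2 hP.ne_zero
  have hsn : s = n := by
    have h3 := natDegree_le_of_dvd h1 (Finset.prod_ne_zero_iff.2 fun i _ => X_sub_C_ne_zero _)
    have h4 := natDegree_le_of_dvd h2 hP0
    rw [natDegree_finsetProd_X_sub_C_eq_card, Finset.card_range,
      natDegree_map_eq_of_injective (ramify_injective m)] at h3 h4
    omega
  rw [hsn] at hdvd
  obtain ⟨t, ht⟩ := hdvd
  have ht0 : 0 < t := Nat.pos_of_ne_zero fun h => m.ne_zero (by rw [ht, h, mul_zero])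
  lift t to ℕ+ using ht0
  have hm : m = t * n := PNat.eq (by rw [ht, PNat.mul_coe, mul_comm])
  -- `z` is fixed by `u ^ n`, which has order `t = m / n`, so it is a series in `X ^ t`.
  obtain ⟨w, rfl⟩ : ∃ w, ramify t w = z := by
    refine exists_ramify_eq_of_twist_eq (u ^ (n : ℕ)) t ?_ z ?_
    · rw [orderOf_pow_of_dvd n.ne_zero (by rw [hu, ht]; exact dvd_mul_right _ _), hu, ht,
        Nat.mul_div_cancel_left _ n.pos]
    · rw [← twist_iterate, ← hsn]
      exact Function.iterate_minimalPeriod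
  obtain ⟨v, hv⟩ := exists_unit_orderOf_eq k n
  refine splits_map_ramify_of_root hP v n hv (z := w) (ramify_injective t ?_)
  rw [map_zero, ← hz, substAt, substAt, hm, ← ramify_comp, ← map_map, eval_map_apply]

theorem splits_map_ramify (F : k⸨X⸩[X]) (ν : ℕ+)
    (hν : ∀ d : ℕ, 0 < d → d ≤ F.natDegree → d ∣ ν) : (F.map (ramify ν)).Splits := by
  induction F using WfDvdMonoid.induction_on_irreducible with
  | zero => simp
  | unit u hu =>
    obtain ⟨c, -, rfl⟩ := isUnit_iff.1 hu
    rw [map_C]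
    exact Splits.C _
  | mul a P ha hP ih =>
    have hd : (P * a).natDegree = P.natDegree + a.natDegree := natDegree_mul hP.ne_zero ha
    rw [Polynomial.map_mul]
    refine Splits.mul ?_ (ih fun d hd1 hd2 => hν d hd1 (by omega))
    have hpos : 0 < P.natDegree := hP.natDegree_pos
    obtain ⟨t, ht⟩ := hν P.natDegree hpos (by omega)
    have ht0 : 0 < t := Nat.pos_of_ne_zero fun h => ν.ne_zero (by rw [ht, h, mul_zero])
    lift t to ℕ+ using ht0
    obtain ⟨d, hdP⟩ : ∃ d : ℕ+, P.natDegree = d := ⟨⟨_, hpos⟩, rfl⟩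
    have hmul : ν = t * d := PNat.eq (by rw [ht, PNat.mul_coe, mul_comm, hdP])
    rw [hmul, ← ramify_comp, ← map_map]
    exact (splits_map_ramify_natDegree hP d hdP).map _

theorem splits_map_ramify_ramIndex (F : k⸨X⸩[X]) : (F.map (ramify (ramIndex F))).Splits :=
  splits_map_ramify F _ fun _ hd hd' => Nat.dvd_factorial hd hd'

end Splitting

/-! ### Intersection multiplicity as the order of a resultant -/

section Resultant

variable {k : Type*} [Field k]

theorem orderTop_multiset_prod (s : Multiset k⸨X⸩) :
    s.prod.orderTop = (s.map HahnSeries.orderTop).sum := by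
  induction s using Multiset.induction_on with
  | empty => simp
  | cons a s ih => rw [Multiset.prod_cons, HahnSeries.orderTop_mul, ih, Multiset.map_cons,
      Multiset.sum_cons]

theorem orderTop_pow_eq (x : k⸨X⸩) (n : ℕ) : (x ^ n).orderTop = n • x.orderTop := by
  rw [← Multiset.prod_replicate, orderTop_multiset_prod, Multiset.map_replicate,
    Multiset.sum_replicate]

theorem intMult_comm_of_eq_zero {F G : k⸨X⸩[X]} (h : F = 0 ∨ G = 0) :
    intMult F G = intMult G F := by
  have h1 : ¬ (F ≠ 0 ∧ G ≠ 0) := by tauto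
  have h2 : ¬ (G ≠ 0 ∧ F ≠ 0) := by tauto
  rw [intMult, intMult, if_neg h1, if_neg h2]
  congr 1
  exact propext or_comm

theorem intMult_zero_right {F : k⸨X⸩[X]} (hF : F ≠ 0) (hd : 0 < F.natDegree) :
    intMult F 0 = ⊤ := by
  rw [intMult, if_neg (by simp), if_neg (by simp [hF, hd.ne'])]

variable [IsAlgClosed k] [CharZero k]

theorem intMult_eq_orderTop_resultant {F G : k⸨X⸩[X]} (hF : F ≠ 0) (hG : G ≠ 0) :
    intMult F G = WithTop.map (fun m : ℤ => (m : ℚ)) (F.resultant G).orderTop := by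
  have hν : (((ramIndex F : ℕ) : ℤ) : ℚ) ≠ 0 := by exact_mod_cast (ramIndex F).ne_zero
  have hinj := ramify_injective (k := k) (ramIndex F)
  have key : G.natDegree • (ramify (ramIndex F) F.leadingCoeff).orderTop +
      ((newtonRoots F).map fun z => (substAt (ramIndex F) G z).orderTop).sum =
      WithTop.map (fun n : ℤ => ((ramIndex F : ℕ) : ℤ) * n) (F.resultant G).orderTop := by
    have h := resultant_eq_prod_eval (F.map (ramify (ramIndex F))) (G.map (ramify (ramIndex F)))
      G.natDegree (natDegree_map_le) (splits_map_ramify_ramIndex F)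
    rw [natDegree_map_eq_of_injective hinj, resultant_map_map,
      leadingCoeff_map_of_injective hinj] at h
    rw [← orderTop_ramify, h, HahnSeries.orderTop_mul, orderTop_pow_eq, orderTop_multiset_prod,
      Multiset.map_map]
    rfl
  rw [intMult, if_pos ⟨hF, hG⟩, key, WithTop.map_map]
  congr 1
  funext n
  simp only [Function.comp_apply, Int.cast_mul]
  rw [Int.cast_natCast] at hν ⊢
  rw [mul_div_cancel_left₀ _ hν]

theorem exists_int_of_intMult_ne_top {F G : k⸨X⸩[X]} (hF : F ≠ 0) (hG : G ≠ 0)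
    (h : intMult F G ≠ ⊤) : ∃ a : ℤ, intMult F G = ((a : ℚ) : WithTop ℚ) := by
  rw [intMult_eq_orderTop_resultant hF hG] at h ⊢
  rw [Ne, WithTop.map_eq_top_iff] at h
  obtain ⟨a, ha⟩ := WithTop.ne_top_iff_exists.1 h
  exact ⟨a, by rw [← ha, WithTop.map_coe]⟩

theorem intMult_comm (F G : k⸨X⸩[X]) : intMult F G = intMult G F := by
  by_cases h : F = 0 ∨ G = 0
  · exact intMult_comm_of_eq_zero h
  · rw [not_or] at h
    rw [intMult_eq_orderTop_resultant h.1 h.2, intMult_eq_orderTop_resultant h.2 h.1,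
      resultant_comm]
    congr 1
    rcases neg_one_pow_eq_or k⸨X⸩ (F.natDegree * G.natDegree) with h | h
    · rw [h, one_mul]
    · rw [h, neg_one_mul, HahnSeries.orderTop_neg]

theorem intMult_mul_left {F₁ F₂ G : k⸨X⸩[X]} (h₁ : F₁ ≠ 0) (h₂ : F₂ ≠ 0) (hG : G ≠ 0) :
    intMult (F₁ * F₂) G = intMult F₁ G + intMult F₂ G := by
  rw [intMult_eq_orderTop_resultant (mul_ne_zero h₁ h₂) hG, intMult_eq_orderTop_resultant h₁ hG,
    intMult_eq_orderTop_resultant h₂ hG, natDegree_mul h₁ h₂, resultant_mul_left _ _ _ _ le_rfl,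
    HahnSeries.orderTop_mul]
  exact WithTop.map_add (Int.castAddHom ℚ) _ _

theorem intMult_const {c : k} (hc : c ≠ 0) {G : k⸨X⸩[X]} : intMult (const c) G = 0 := by
  have hc0 : const c ≠ 0 := by
    rwa [const, Ne, C_eq_zero, map_eq_zero_iff _ HahnSeries.C_injective]
  by_cases hG : G = 0
  · rw [intMult, if_neg (by simp [hG]), if_pos (Or.inr ⟨hG, hc0, natDegree_C _⟩)]
  · rw [intMult_eq_orderTop_resultant hc0 hG, const, natDegree_C, resultant_zero_left_deg,
      coeff_C_zero, orderTop_pow_eq, HahnSeries.C_apply,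
      HahnSeries.orderTop_single hc]
    simp

theorem intMult_multiset_prod (s : Multiset k⸨X⸩[X]) (hs : ∀ P ∈ s, P ≠ 0) {G : k⸨X⸩[X]}
    (hG : G ≠ 0) : intMult s.prod G = (s.map fun P => intMult P G).sum := by
  induction s using Multiset.induction_on with
  | empty =>
    have h1 : (1 : k⸨X⸩[X]) = const 1 := by simp [const]
    rw [Multiset.prod_zero, h1, intMult_const one_ne_zero, Multiset.map_zero, Multiset.sum_zero]
  | cons P s ih =>
    have hs' : ∀ Q ∈ s, Q ≠ 0 := fun Q hQ => hs Q (Multiset.mem_cons_of_mem hQ)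
    rw [Multiset.prod_cons, intMult_mul_left (hs P (Multiset.mem_cons_self P s))
      (Multiset.prod_ne_zero fun h => hs' 0 h rfl) hG, ih hs', Multiset.map_cons,
      Multiset.sum_cons]

end Resultant

section Branches

variable {k : Type*} [Field k]

theorem irreducible_of_mem_branches {F P : k⸨X⸩[X]} (hP : P ∈ branches F) : Irreducible P := by
  classical
  exact UniqueFactorizationMonoid.irreducible_of_normalized_factor P hP

theorem dvd_of_mem_branches {F P : k⸨X⸩[X]} (hP : P ∈ branches F) : P ∣ F := by
  classical
  exact UniqueFactorizationMonoid.dvd_of_mem_normalizedFactors hP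

theorem monic_of_mem_branches {F P : k⸨X⸩[X]} (hP : P ∈ branches F) : P.Monic := by
  classical
  have h := UniqueFactorizationMonoid.normalize_normalized_factor P hP
  rw [← h]
  exact monic_normalize (irreducible_of_mem_branches hP).ne_zero

theorem eq_C_mul_prod_branches {F : k⸨X⸩[X]} (hF : F ≠ 0) :
    F = C F.leadingCoeff * (branches F).prod := by
  classical
  have hm : (branches F).prod.Monic := by
    have := monic_multiset_prod_of_monic (branches F) id fun P hP => monic_of_mem_branches hP
    rwa [Multiset.map_id] at this
  obtain ⟨u, hu⟩ : Associated F (branches F).prod :=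
    (UniqueFactorizationMonoid.prod_normalizedFactors hF).symm
  obtain ⟨c, -, hc⟩ := isUnit_iff.1 u.isUnit
  rw [← hu, ← hc, Monic, leadingCoeff_mul, leadingCoeff_C] at hm
  rw [← hu, ← hc, mul_left_comm, ← C_mul, hm, C_1, mul_one]

theorem natDegree_eq_sum_branches {F : k⸨X⸩[X]} (hF : F ≠ 0) :
    F.natDegree = ((branches F).map natDegree).sum := by
  conv_lhs => rw [eq_C_mul_prod_branches hF]
  rw [natDegree_C_mul (leadingCoeff_ne_zero.2 hF), natDegree_multiset_prod]
  exact fun h => (irreducible_of_mem_branches h).ne_zero rfl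

theorem IsKMonic.ne_zero {F : k⸨X⸩[X]} (hF : IsKMonic F) : F ≠ 0 := by
  obtain ⟨a, ha, hlc⟩ := hF
  rintro rfl
  rw [leadingCoeff_zero, eq_comm, map_eq_zero_iff _ HahnSeries.C_injective] at hlc
  exact ha hlc

/-- The leading coefficient of a `k`-monic `F` is a constant, so the intersection multiplicity
with `F` is the sum over the branches of `F`. -/
theorem intMult_eq_sum_branches [IsAlgClosed k] [CharZero k] {F G : k⸨X⸩[X]} (hF : IsKMonic F)
    (hG : G ≠ 0) : intMult F G = ((branches F).map fun P => intMult P G).sum := by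
  have hF0 : F ≠ 0 := hF.ne_zero
  obtain ⟨a, ha, hlc⟩ := hF
  have h0 : ∀ P ∈ branches F, P ≠ 0 := fun P hP => (irreducible_of_mem_branches hP).ne_zero
  have hc0 : const a ≠ 0 := by
    rwa [const, Ne, C_eq_zero, map_eq_zero_iff _ HahnSeries.C_injective]
  conv_lhs => rw [eq_C_mul_prod_branches hF0, hlc]
  rw [← intMult_multiset_prod _ h0 hG]
  exact (intMult_mul_left hc0 (Multiset.prod_ne_zero fun h => h0 0 h rfl) hG).trans (by
    rw [intMult_const ha, zero_add])

end Branches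

/-! ### The identity on a single branch -/

section Branch

variable {k : Type*} [Field k]

theorem substAt_sub_const (ν : ℕ+) (G : k⸨X⸩[X]) (c : k) (z : k⸨X⸩) :
    substAt ν (G - const c) z = substAt ν G z - HahnSeries.C c := by
  rw [substAt, substAt, const, Polynomial.map_sub, map_C, ramify_C, eval_sub, eval_C]

theorem substAt_eq_zero_of_mem_newtonRoots {P : k⸨X⸩[X]} {z : k⸨X⸩} (hz : z ∈ newtonRoots P) :
    substAt (ramIndex P) P z = 0 :=
  (mem_roots'.1 hz).2

/-- `X ^ ν G_X(X ^ ν, z)` has the order of `G(X ^ ν, z)` stripped of its constant term, if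
`G_Y` vanishes at `z`. -/
theorem orderTop_substAt_derivX [CharZero k] {ν : ℕ+} {G : k⸨X⸩[X]} {z : k⸨X⸩}
    (h : substAt ν (derivative G) z = 0) :
    (((ν : ℕ) : ℤ) : WithTop ℤ) + (substAt ν (derivX G) z).orderTop =
      (substAt ν G z - HahnSeries.C ((substAt ν G z).coeff 0)).orderTop := by
  have hν : ((ν : ℕ) : k) ≠ 0 := by exact_mod_cast ν.ne_zero
  have hC : ((ν : ℕ) : k⸨X⸩) = HahnSeries.single 0 ((ν : ℕ) : k) := by
    rw [← HahnSeries.C_apply, map_natCast]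
  rw [← orderTop_euler, euler_substAt, h, zero_mul, add_zero, HahnSeries.orderTop_mul,
    HahnSeries.orderTop_mul, hC, HahnSeries.orderTop_single hν,
    HahnSeries.orderTop_single one_ne_zero, WithTop.coe_zero, zero_add]

theorem substAt_ne_zero_of_intMult_ne_top {P G : k⸨X⸩[X]} (hP : Irreducible P)
    (h : intMult P G ≠ ⊤) {z : k⸨X⸩} (hz : z ∈ newtonRoots P) :
    substAt (ramIndex P) G z ≠ 0 := by
  intro h0
  by_cases hG : G = 0
  · exact h (hG ▸ intMult_zero_right hP.ne_zero hP.natDegree_pos)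
  · refine h ?_
    obtain ⟨s, hs⟩ := Multiset.exists_cons_of_mem hz
    rw [intMult, if_pos ⟨hP.ne_zero, hG⟩, hs, Multiset.map_cons, Multiset.sum_cons, h0,
      HahnSeries.orderTop_zero, top_add, add_top, WithTop.map_top]

theorem HasResidue.eq_coeff_zero {P G : k⸨X⸩[X]} {z : k⸨X⸩}
    (hz : z ∈ newtonRoots P) {c : k} (h : HasResidue P G c) :
    c = (substAt (ramIndex P) G z).coeff 0 := by
  have := HahnSeries.coeff_eq_zero_of_lt_orderTop (i := 0) (h z hz)
  rw [HahnSeries.coeff_sub, HahnSeries.C_apply, HahnSeries.coeff_single_same, sub_eq_zero] at this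
  exact this.symm

variable [IsAlgClosed k] [CharZero k]

theorem card_newtonRoots (P : k⸨X⸩[X]) : (newtonRoots P).card = P.natDegree := by
  rw [newtonRoots, ← (splits_map_ramify_ramIndex P).natDegree_eq_card_roots,
    natDegree_map_eq_of_injective (ramify_injective _)]

theorem exists_mem_newtonRoots {P : k⸨X⸩[X]} (hP : Irreducible P) : ∃ z, z ∈ newtonRoots P := by
  refine Multiset.card_pos_iff_exists_mem.1 ?_
  rw [card_newtonRoots]
  exact hP.natDegree_pos

/-- All roots contribute equally to `int(P, G)` when the values of `G` there have a common order. -/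
theorem intMult_eq_of_orderTop_eq {P G : k⸨X⸩[X]} (hP : Irreducible P) (hm : P.Monic) {d : ℤ}
    (h : ∀ z ∈ newtonRoots P, (substAt (ramIndex P) G z).orderTop = d) :
    intMult P G = (((P.natDegree : ℚ) * d / ((ramIndex P : ℕ) : ℚ) : ℚ) : WithTop ℚ) := by
  have hG : G ≠ 0 := by
    rintro rfl
    obtain ⟨z, hz⟩ := exists_mem_newtonRoots hP
    have := h z hz
    simp [substAt] at this
  have h1 : (newtonRoots P).map (fun z => (substAt (ramIndex P) G z).orderTop) =
      (newtonRoots P).map fun _ => (d : WithTop ℤ) := Multiset.map_congr rfl h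
  have h2 : (P.natDegree • (d : WithTop ℤ)) = ((P.natDegree • d : ℤ) : WithTop ℤ) :=
    (WithTop.coe_nsmul d P.natDegree).symm
  rw [intMult, if_pos ⟨hP.ne_zero, hG⟩, h1, hm.leadingCoeff, map_one, HahnSeries.orderTop_one,
    smul_zero, zero_add, Multiset.map_const', Multiset.sum_replicate, card_newtonRoots, h2,
    WithTop.map_coe, nsmul_eq_mul]
  push_cast
  rfl

/-- The values of `G` at the roots of an irreducible `P` are conjugate. -/
theorem exists_twist_substAt_eq {P : k⸨X⸩[X]} (hP : Irreducible P) (G : k⸨X⸩[X]) {z w : k⸨X⸩}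
    (hz : z ∈ newtonRoots P) (hw : w ∈ newtonRoots P) :
    ∃ u : kˣ, twist u (substAt (ramIndex P) G z) = substAt (ramIndex P) G w := by
  obtain ⟨u, hu⟩ := exists_unit_orderOf_eq k (ramIndex P)
  obtain ⟨i, hi⟩ := exists_twist_eq_of_roots hP u _ hu (substAt_eq_zero_of_mem_newtonRoots hz)
    (substAt_eq_zero_of_mem_newtonRoots hw)
  refine ⟨u ^ i, ?_⟩
  rw [twist_substAt _ _ (by rw [← pow_mul, mul_comm, pow_mul, ← hu, pow_orderOf_eq_one, one_pow]),
    hi]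

theorem orderTop_substAt_eq {P : k⸨X⸩[X]} (hP : Irreducible P) (G : k⸨X⸩[X]) {z w : k⸨X⸩}
    (hz : z ∈ newtonRoots P) (hw : w ∈ newtonRoots P) :
    (substAt (ramIndex P) G w).orderTop = (substAt (ramIndex P) G z).orderTop := by
  obtain ⟨u, hu⟩ := exists_twist_substAt_eq hP G hz hw
  rw [← hu, orderTop_twist]

theorem hasResidue_iff {P : k⸨X⸩[X]} (hP : Irreducible P) (G : k⸨X⸩[X]) {z : k⸨X⸩}
    (hz : z ∈ newtonRoots P) (c : k) :
    HasResidue P G c ↔ 0 < (substAt (ramIndex P) G z - HahnSeries.C c).orderTop := by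
  refine ⟨fun h => h z hz, fun h w hw => ?_⟩
  rw [← substAt_sub_const] at h ⊢
  rwa [orderTop_substAt_eq hP _ hz hw]

theorem res_eq_coe_iff {P : k⸨X⸩[X]} (hP : Irreducible P) (G : k⸨X⸩[X]) (c : k) :
    res P G = (c : OnePoint k) ↔ HasResidue P G c := by
  obtain ⟨z, hz⟩ := exists_mem_newtonRoots hP
  constructor
  · intro h
    rw [res] at h
    split_ifs at h with hex
    · rw [OnePoint.coe_eq_coe] at h
      exact h ▸ hex.choose_spec
    · exact absurd h (OnePoint.infty_ne_coe c)
  · intro h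
    have hex : ∃ c : k, HasResidue P G c := ⟨c, h⟩
    rw [res, dif_pos hex, OnePoint.coe_eq_coe, hex.choose_spec.eq_coeff_zero hz,
      h.eq_coeff_zero hz]

/-- The beta-derivative identity on a branch `P`. Every root `z` of `P` contributes
`ord (g - g₀) - ν` to `int(P, G_X)`, where `g = G(X ^ ν, z)` and `g₀` is its constant term. If
`ord g ≠ 0`, this is `ord g - ν`, and the residue is not a nonzero constant; otherwise `g₀` is the
residue, `ord g = 0`, and `ord (g - g₀)` is the contribution to the beta invariant. -/
theorem branch_identity {P G : k⸨X⸩[X]} (hP : Irreducible P) (hm : P.Monic)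
    (hGCD : ∀ c : k, GCDOne P (G - const c)) (hdvd : P ∣ derivative G) :
    ∃ a b e : ℤ, intMult P (derivX G) = ((a : ℚ) : WithTop ℚ) ∧
      intMult P G = ((b : ℚ) : WithTop ℚ) ∧
      ((∃ c : k, c ≠ 0 ∧ res P G = (c : OnePoint k) ∧
          intMult P (G - const c) = ((e : ℚ) : WithTop ℚ)) ∨
        ((∀ c : k, c ≠ 0 → res P G ≠ (c : OnePoint k)) ∧ e = 0)) ∧
      a = b - (P.natDegree : ℤ) + e := by
  have hν : ((ramIndex P : ℕ) : ℚ) ≠ 0 := by exact_mod_cast (ramIndex P).ne_zero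
  obtain ⟨z, hz⟩ := exists_mem_newtonRoots hP
  set g := substAt (ramIndex P) G z with hg
  set c := g.coeff 0 with hc
  have hne : ∀ c : k, G - const c ≠ 0 := fun c h =>
    hGCD c (h ▸ intMult_zero_right hP.ne_zero hP.natDegree_pos)
  have hconst0 : G - const 0 = G := by simp [const]
  have hG0 : G ≠ 0 := hconst0 ▸ hne 0
  have hGtop : intMult P G ≠ ⊤ := by
    have := hGCD 0
    rwa [GCDOne, hconst0] at this
  obtain ⟨b, hb⟩ := exists_int_of_intMult_ne_top hP.ne_zero hG0 hGtop
  obtain ⟨e, he⟩ := exists_int_of_intMult_ne_top hP.ne_zero (hne c) (hGCD c)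
  have hg0 : g ≠ 0 := substAt_ne_zero_of_intMult_ne_top hP hGtop hz
  have hgc : g - HahnSeries.C c ≠ 0 := by
    have := substAt_ne_zero_of_intMult_ne_top hP (hGCD c) hz
    rwa [substAt_sub_const] at this
  obtain ⟨d, hd⟩ := WithTop.ne_top_iff_exists.1 (HahnSeries.orderTop_ne_top.2 hg0)
  obtain ⟨d', hd'⟩ := WithTop.ne_top_iff_exists.1 (HahnSeries.orderTop_ne_top.2 hgc)
  -- Removing the constant term of `g` changes its order `d` only if `d = 0`.
  have hcoeff : ∀ n, n ≠ 0 → (g - HahnSeries.C c).coeff n = g.coeff n := fun n hn => by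
    rw [HahnSeries.coeff_sub, HahnSeries.C_apply, HahnSeries.coeff_single_of_ne hn, sub_zero]
  have hdne : g.coeff d ≠ 0 := HahnSeries.coeff_orderTop_ne hd.symm
  have hd'ne : (g - HahnSeries.C c).coeff d' ≠ 0 := HahnSeries.coeff_orderTop_ne hd'.symm
  have hdmin : ∀ n, g.coeff n ≠ 0 → d ≤ n := fun n hn => by
    have := HahnSeries.orderTop_le_of_coeff_ne_zero hn
    rw [← hd] at this
    exact_mod_cast this
  have hd'0 : d' ≠ 0 := by
    rintro rfl
    refine hd'ne ?_
    rw [HahnSeries.coeff_sub, HahnSeries.C_apply, HahnSeries.coeff_single_same, sub_self]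
  have hd'ne' : g.coeff d' ≠ 0 := hcoeff d' hd'0 ▸ hd'ne
  have hdd : d ≠ 0 → d = d' := fun h0 => by
    refine le_antisymm (hdmin d' hd'ne') ?_
    have := HahnSeries.orderTop_le_of_coeff_ne_zero (x := g - HahnSeries.C c) (g := d)
      (by rwa [hcoeff d h0])
    rw [← hd'] at this
    exact_mod_cast this
  have hbd := intMult_eq_of_orderTop_eq hP hm (G := G) (d := d) fun w hw => by
    rw [orderTop_substAt_eq hP G hz hw, hd]
  have hed := intMult_eq_of_orderTop_eq hP hm (G := G - const c) (d := d') fun w hw => by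
    rw [orderTop_substAt_eq hP _ hz hw, substAt_sub_const, hd']
  have had := intMult_eq_of_orderTop_eq hP hm (G := derivX G)
    (d := d' - ((ramIndex P : ℕ) : ℤ)) fun w hw => by
    have hY : substAt (ramIndex P) (derivative G) z = 0 :=
      eval_eq_zero_of_dvd_of_eval_eq_zero (Polynomial.map_dvd _ hdvd)
        (substAt_eq_zero_of_mem_newtonRoots hz)
    have h := orderTop_substAt_derivX hY
    rw [← hg, ← hc, ← hd'] at h
    rw [orderTop_substAt_eq hP _ hz hw]
    generalize (substAt (ramIndex P) (derivX G) z).orderTop = x at h ⊢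
    induction x using WithTop.recTopCoe with
    | top => simp at h
    | coe x =>
      have h' : ((ramIndex P : ℕ) : ℤ) + x = d' := by exact_mod_cast h
      rw [← h', add_sub_cancel_left]
  rw [hb, WithTop.coe_inj] at hbd
  rw [he, WithTop.coe_inj] at hed
  have ha : intMult P (derivX G) = (((e - (P.natDegree : ℤ) : ℤ) : ℚ) : WithTop ℚ) := by
    rw [had, WithTop.coe_inj]
    push_cast
    rw [hed]
    field_simp
  refine ⟨e - P.natDegree, b, if d = 0 then e else 0, ha, hb, ?_, ?_⟩
  · split_ifs with h0
    · have hc0 : c ≠ 0 := by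
        rw [h0] at hdne
        exact hdne
      refine Or.inl ⟨c, hc0, (res_eq_coe_iff hP G c).2 ((hasResidue_iff hP G hz c).2 ?_), he⟩
      rw [← hg, ← hd']
      exact_mod_cast lt_of_le_of_ne (h0 ▸ hdmin d' hd'ne') (Ne.symm hd'0)
    · refine Or.inr ⟨fun c' hc' hres => ?_, rfl⟩
      have hres' := (res_eq_coe_iff hP G c').1 hres
      have hcc : c' = c := hres'.eq_coeff_zero hz
      have hpos := (hasResidue_iff hP G hz c').1 hres'
      rw [← hg, hcc, ← hd', ← hdd h0] at hpos
      have h1 : d ≤ 0 := hdmin 0 (by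
        rw [← hc, ← hcc]
        exact hc')
      have h2 : 0 < d := by exact_mod_cast hpos
      omega
  · split_ifs with h0
    · have hb0 : b = 0 := by
        rw [h0, Int.cast_zero, mul_zero, zero_div] at hbd
        exact_mod_cast hbd
      rw [hb0]
      ring
    · have hbe : b = e := by
        rw [hdd h0, ← hed] at hbd
        exact_mod_cast hbd
      rw [hbe]
      ring

end Branch

/-! ### Summation over the branches -/

section Sum

theorem sum_int_identity {ι : Type*} (s : Multiset ι) (x y w : ι → WithTop ℚ) (n : ι → ℕ)
    (h : ∀ i ∈ s, ∃ a b e : ℤ, x i = ((a : ℚ) : WithTop ℚ) ∧ y i = ((b : ℚ) : WithTop ℚ) ∧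
      w i = ((e : ℚ) : WithTop ℚ) ∧ a = b - (n i : ℤ) + e) :
    ∃ a b e : ℤ, (s.map x).sum = ((a : ℚ) : WithTop ℚ) ∧
      (s.map y).sum = ((b : ℚ) : WithTop ℚ) ∧ (s.map w).sum = ((e : ℚ) : WithTop ℚ) ∧
      a = b - ((s.map n).sum : ℤ) + e := by
  induction s using Multiset.induction_on with
  | empty => exact ⟨0, 0, 0, by simp⟩
  | cons i s ih =>
    obtain ⟨a, b, e, ha, hb, he, h1⟩ := ih fun j hj => h j (Multiset.mem_cons_of_mem hj)
    obtain ⟨a', b', e', ha', hb', he', h2⟩ := h i (Multiset.mem_cons_self i s)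
    refine ⟨a' + a, b' + b, e' + e, ?_, ?_, ?_, ?_⟩
    · rw [Multiset.map_cons, Multiset.sum_cons, ha, ha', Int.cast_add, WithTop.coe_add]
    · rw [Multiset.map_cons, Multiset.sum_cons, hb, hb', Int.cast_add, WithTop.coe_add]
    · rw [Multiset.map_cons, Multiset.sum_cons, he, he', Int.cast_add, WithTop.coe_add]
    · rw [Multiset.map_cons, Multiset.sum_cons, Nat.cast_add]
      linarith

variable {k : Type*} [Field k]

open Classical in
theorem betaAt_eq_sum_branches (c : k) (F G : k⸨X⸩[X]) :
    betaAt c F G = ((branches F).map fun P =>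
      if res P G = (c : OnePoint k) then intMult P (G - const c) else 0).sum := by
  rw [betaAt, alphaAt]
  induction branches F using Multiset.induction_on with
  | empty => simp
  | cons P s ih =>
    by_cases h : res P G = (c : OnePoint k)
    · simp [h, ih]
    · simp [h, ih]

variable [IsAlgClosed k] [CharZero k]

/-- The beta-derivative identity, by summation of `branch_identity` over the branches of `F`. The
summands for the beta invariant are regrouped according to the residue of the branch. -/
theorem beta_derivative_identity {F G : k⸨X⸩[X]} (hF : IsKMonic F)
    (hGCD : ∀ c : k, GCDOne F (G - const c)) (hdvd : ∀ P ∈ branches F, P ∣ derivative G) :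
    ∃ a b e : ℤ, intMult F (derivX G) = ((a : ℚ) : WithTop ℚ) ∧
      intMult F G = ((b : ℚ) : WithTop ℚ) ∧ beta F G = ((e : ℚ) : WithTop ℚ) ∧
      a = b - (F.natDegree : ℤ) + e := by
  classical
  have hF0 : F ≠ 0 := hF.ne_zero
  -- For `F` constant, `G` and `G_X` may vanish, but all terms are zero.
  rcases Nat.eq_zero_or_pos F.natDegree with hN | hN
  · have hbr : branches F = 0 := by
      refine Multiset.eq_zero_of_forall_notMem fun P hP => ?_
      have h1 := Multiset.single_le_sum (fun _ _ => Nat.zero_le _) _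
        (Multiset.mem_map_of_mem natDegree hP)
      have h2 := (irreducible_of_mem_branches hP).natDegree_pos
      rw [← natDegree_eq_sum_branches hF0] at h1
      omega
    obtain ⟨a, ha, hlc⟩ := hF
    have hFa : F = const a := by
      rw [eq_C_mul_prod_branches hF0, hbr, Multiset.prod_zero, mul_one, hlc]
      rfl
    refine ⟨0, 0, 0, ?_, ?_, ?_, ?_⟩
    · rw [hFa, intMult_const ha]; rfl
    · rw [hFa, intMult_const ha]; rfl
    · rw [beta]
      simp [betaAt_eq_sum_branches, hbr]
    · rw [hN]
      simp
  have hne : ∀ c : k, G - const c ≠ 0 := fun c h => hGCD c (h ▸ intMult_zero_right hF0 hN)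
  have hG : G ≠ 0 := by simpa [const] using hne 0
  have hbranch : ∀ P ∈ branches F, ∀ c : k, GCDOne P (G - const c) := fun P hP c h => by
    refine hGCD c ?_
    obtain ⟨s, hs⟩ := Multiset.exists_cons_of_mem hP
    rw [intMult_eq_sum_branches hF (hne c), hs, Multiset.map_cons, Multiset.sum_cons, h, top_add]
  have hid := fun P (hP : P ∈ branches F) => branch_identity (irreducible_of_mem_branches hP)
    (monic_of_mem_branches hP) (hbranch P hP) (hdvd P hP)
  have hGX : derivX G ≠ 0 := fun h => by
    obtain ⟨P, hP⟩ : ∃ P, P ∈ branches F := by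
      refine Multiset.exists_mem_of_ne_zero fun h => ?_
      rw [natDegree_eq_sum_branches hF0, h] at hN
      simp at hN
    obtain ⟨a, -, -, ha, -⟩ := hid P hP
    rw [h, intMult_zero_right (irreducible_of_mem_branches hP).ne_zero
      (irreducible_of_mem_branches hP).natDegree_pos] at ha
    exact WithTop.top_ne_coe ha
  set S : Finset k := ((alpha_finite F G).subset (Set.sdiff_subset (t := {0}))).toFinset with hS
  obtain ⟨a, b, e, ha, hb, he, habe⟩ := sum_int_identity (branches F)
    (fun P => intMult P (derivX G)) (fun P => intMult P G)
    (fun P => ∑ c ∈ S, if res P G = (c : OnePoint k) then intMult P (G - const c) else 0)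
    natDegree fun P hP => by
      obtain ⟨a, b, e, ha, hb, he, habe⟩ := hid P hP
      refine ⟨a, b, e, ha, hb, ?_, habe⟩
      rcases he with ⟨c, hc, hres, he⟩ | ⟨hres, he⟩
      · have hcS : c ∈ S := by
          rw [hS, Set.Finite.mem_toFinset]
          exact ⟨Multiset.card_pos.1 (Multiset.card_pos_iff_exists_mem.2
            ⟨P, Multiset.mem_filter.2 ⟨hP, hres⟩⟩), hc⟩
        rw [Finset.sum_eq_single_of_mem c hcS, if_pos hres, he]
        intro c' _ hc'
        rw [if_neg]
        rw [hres, OnePoint.coe_eq_coe]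
        exact hc'.symm
      · rw [he]
        refine Finset.sum_eq_zero fun c hc => if_neg (hres c ?_)
        rw [hS, Set.Finite.mem_toFinset] at hc
        exact hc.2
  refine ⟨a, b, e, ?_, ?_, ?_, ?_⟩
  · rw [intMult_eq_sum_branches hF hGX, ha]
  · rw [intMult_eq_sum_branches hF hG, hb]
  · rw [← he, beta, ← hS]
    simp only [betaAt_eq_sum_branches]
    exact Multiset.sum_map_sum_map _ _
  · rw [natDegree_eq_sum_branches hF0, habe]

end Sum

end MeromorphicCurve

theorem mainTheorem2 {k : Type*} [Field k] [IsAlgClosed k] [CharZero k] :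
    (∀ F G : k⸨X⸩[X], IsKMonic F → (∀ c : k, GCDOne F (G - const c)) →
      (∀ P ∈ branches F, P ∣ derivative G) →
      ∃ a b e : ℤ,
        intMult F (derivX G) = ((a : ℚ) : WithTop ℚ) ∧
        intMult F G = ((b : ℚ) : WithTop ℚ) ∧
        beta F G = ((e : ℚ) : WithTop ℚ) ∧
        a = b - (F.natDegree : ℤ) + e) ∧
    (∀ F : k⸨X⸩[X], IsKMonic F → 0 < F.natDegree →
      (∀ c : k, GCDOne (derivative F) (F - const c)) →
      ∃ a b e : ℤ,
        intMult (derivX F) (derivative F) = ((a : ℚ) : WithTop ℚ) ∧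
        intMult F (derivative F) = ((b : ℚ) : WithTop ℚ) ∧
        betaBar F = ((e : ℚ) : WithTop ℚ) ∧
        a = b - (F.natDegree : ℤ) + 1 + e) := by
  refine ⟨fun F G hF hGCD hdvd => beta_derivative_identity hF hGCD hdvd,
    fun F hF hpos hGCD => ?_⟩
  obtain ⟨a, ha, hlc⟩ := hF
  have : CharZero k⸨X⸩ := charZero_of_injective_ringHom HahnSeries.C_injective
  have hdeg : (derivative F).natDegree = F.natDegree - 1 := natDegree_derivative F
  have hF' : IsKMonic (derivative F) := by
    refine ⟨F.natDegree * a, mul_ne_zero (by exact_mod_cast hpos.ne') ha, ?_⟩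
    rw [leadingCoeff, hdeg, coeff_derivative, Nat.sub_add_cancel hpos, coeff_natDegree, hlc,
      map_mul, map_natCast, mul_comm]
    congr 1
    rw [← Nat.cast_succ, Nat.succ_eq_add_one, Nat.sub_add_cancel hpos]
  obtain ⟨a, b, e, ha, hb, he, h⟩ := beta_derivative_identity hF' hGCD fun P hP =>
    dvd_of_mem_branches hP
  refine ⟨a, b, e, by rw [intMult_comm, ha], by rw [intMult_comm, hb], he, ?_⟩
  rw [h, hdeg, Nat.cast_sub hpos]
  push_cast
  ring
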